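/- Let $K$ be a field. For $k\in\mathbb N$ let $K[x]_{\le k}$ be the space of polynomials of degree at most $k$, and let $a_i=x^i$ ($0\le i\le n$), $b_j=x^j$ ($0\le j\le m$), $c_k=x^k$ ($0\le k\le n+m$) be the monomial bases of $K[x]_{\le n}$, $K[x]_{\le m}$, $K[x]_{\le n+m}$. The polynomial multiplication tensor for degrees $n$ and $m$ over $K$ is $$T_{n,m}^K=\sum_{i=0}^n\sum_{j=0}^m a_i\otimes b_j\otimes c_{i+j}\in K[x]_{\le n}\otimes K[x]_{\le m}\otimes K[x]_{\le n+m},$$ and this sum is its standard representation. A representation of a tensor $T\in U\otimes V\otimes W$ is a finite multiset of pure tensors $u\otimes v\otimes w$ with $u,v,w\neq0$ whose sum is $T$, and the rank of $T$ is the smallest number of terms of a representation of $T$. A flip replaces two terms that agree in one position, say $u\otimes v\otimes w$ and $u\otimes v'\otimes w'$, by $u\otimes(v-\lambda v')\otimes w$ and $u\otimes v'\otimes(w'+\lambda w)$ for some $\lambda\in K$; a reduction replaces two terms that agree in two positions, say $u\otimes v\otimes w$ and $u'\otimes v\otimes w$, by $(u+u')\otimes v\otimes w$; likewise for the other positions.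 The flip graph of $T$ is the directed graph whose vertices are the representations of $T$, with an edge from $S$ to $S'$ whenever $S'$ is obtained from $S$ by a flip or a reduction. Theorem. (a) Let $K=\mathbb Z_2$ be the field with two elements. For each $$(n,m)\in\{(1,1),(1,2),(1,3),(1,4),(1,5),(2,2),(2,3),(2,4),(3,3)\},$$ the flip graph of $T_{n,m}^{\mathbb Z_2}$ has a directed path from the standard representation to a representation whose number of terms is the rank of $T_{n,m}^{\mathbb Z_2}$; and these ranks are, in this order, $3,5,6,8,9,6,8,10,9$. (b) In contrast, for every field $K$ with at least $5$ elements, the rank of $T_{2,2}^K$ is $5$. -/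

import Mathlib

open scoped TensorProduct

section Representations

variable {K U V W : Type*} [Field K] [AddCommGroup U] [AddCommGroup V] [AddCommGroup W]
  [Module K U] [Module K V] [Module K W]

/-- Pure tensors, i.e. tensors of rank one: `u ⊗ v ⊗ w` with nonzero factors. -/
def IsPureTensor (t : U ⊗[K] V ⊗[K] W) : Prop :=
  ∃ (u : U) (v : V) (w : W), u ≠ 0 ∧ v ≠ 0 ∧ w ≠ 0 ∧ t = u ⊗ₜ[K] v ⊗ₜ[K] w

/-- A representation of the tensor `T`: a finite unordered collection of pure tensors
(repetitions allowed) whose sum is `T`. -/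
structure TensorRep (T : U ⊗[K] V ⊗[K] W) where
  terms : Multiset (U ⊗[K] V ⊗[K] W)
  pure : ∀ t ∈ terms, IsPureTensor t
  sum_eq : terms.sum = T

/-- The number of terms of a representation. -/
def TensorRep.length {T : U ⊗[K] V ⊗[K] W} (S : TensorRep T) : ℕ :=
  Multiset.card S.terms

/-- The rank of a tensor: the least number of terms of a representation. -/
noncomputable def tensorRank (T : U ⊗[K] V ⊗[K] W) : ℕ :=
  sInf (Set.range fun S : TensorRep T => S.length)

/-- `FlipPair s t s' t'`: the terms `s, t` agree in one position, and the flip with some parameter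
`l` replaces them by `s', t'`. One constructor for each position in which the terms agree.
(Interchanging the roles of the two other positions amounts to interchanging the two terms and
replacing `l` by `-l`.) -/
inductive FlipPair : U ⊗[K] V ⊗[K] W → U ⊗[K] V ⊗[K] W →
    U ⊗[K] V ⊗[K] W → U ⊗[K] V ⊗[K] W → Prop
  | first (l : K) (u : U) (v v' : V) (w w' : W) :
      FlipPair (u ⊗ₜ[K] v ⊗ₜ[K] w) (u ⊗ₜ[K] v' ⊗ₜ[K] w')
        (u ⊗ₜ[K] (v - l • v') ⊗ₜ[K] w) (u ⊗ₜ[K] v' ⊗ₜ[K] (w' + l • w))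
  | second (l : K) (u u' : U) (v : V) (w w' : W) :
      FlipPair (u ⊗ₜ[K] v ⊗ₜ[K] w) (u' ⊗ₜ[K] v ⊗ₜ[K] w')
        ((u - l • u') ⊗ₜ[K] v ⊗ₜ[K] w) (u' ⊗ₜ[K] v ⊗ₜ[K] (w' + l • w))
  | third (l : K) (u u' : U) (v v' : V) (w : W) :
      FlipPair (u ⊗ₜ[K] v ⊗ₜ[K] w) (u' ⊗ₜ[K] v' ⊗ₜ[K] w)
        ((u - l • u') ⊗ₜ[K] v ⊗ₜ[K] w) (u' ⊗ₜ[K] (v' + l • v) ⊗ₜ[K] w)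

/-- `ReductionPair s t r`: the terms `s, t` agree in two positions and merge into `r`. -/
inductive ReductionPair : U ⊗[K] V ⊗[K] W → U ⊗[K] V ⊗[K] W → U ⊗[K] V ⊗[K] W → Prop
  | first (u u' : U) (v : V) (w : W) :
      ReductionPair (u ⊗ₜ[K] v ⊗ₜ[K] w) (u' ⊗ₜ[K] v ⊗ₜ[K] w) ((u + u') ⊗ₜ[K] v ⊗ₜ[K] w)
  | second (u : U) (v v' : V) (w : W) :
      ReductionPair (u ⊗ₜ[K] v ⊗ₜ[K] w) (u ⊗ₜ[K] v' ⊗ₜ[K] w) (u ⊗ₜ[K] (v + v') ⊗ₜ[K] w)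
  | third (u : U) (v : V) (w w' : W) :
      ReductionPair (u ⊗ₜ[K] v ⊗ₜ[K] w) (u ⊗ₜ[K] v ⊗ₜ[K] w') (u ⊗ₜ[K] v ⊗ₜ[K] (w + w'))

/-- `S'` arises from `S` by a flip of two of its terms. -/
def TensorRep.IsFlip {T : U ⊗[K] V ⊗[K] W} (S S' : TensorRep T) : Prop :=
  ∃ (R : Multiset (U ⊗[K] V ⊗[K] W)) (s t s' t' : U ⊗[K] V ⊗[K] W),
    FlipPair s t s' t' ∧ S.terms = s ::ₘ t ::ₘ R ∧ S'.terms = s' ::ₘ t' ::ₘ R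

/-- `S'` arises from `S` by a reduction of two of its terms. -/
def TensorRep.IsReduction {T : U ⊗[K] V ⊗[K] W} (S S' : TensorRep T) : Prop :=
  ∃ (R : Multiset (U ⊗[K] V ⊗[K] W)) (s t r : U ⊗[K] V ⊗[K] W),
    ReductionPair s t r ∧ S.terms = s ::ₘ t ::ₘ R ∧ S'.terms = r ::ₘ R

/-- The flip graph of a tensor. Edges are directed, so that a reduction cannot be traversed
backwards (this would be a split). -/
def flipGraph (T : U ⊗[K] V ⊗[K] W) : Digraph (TensorRep T) where
  Adj S S' := S.IsFlip S' ∨ S.IsReduction S'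

/-- There is a (possibly trivial) directed path in the flip graph from `S` to `S'`. -/
def HasFlipPath {T : U ⊗[K] V ⊗[K] W} (S S' : TensorRep T) : Prop :=
  Relation.ReflTransGen (flipGraph T).Adj S S'

end Representations

section PolynomialMultiplication

variable (K : Type*) [Field K]

/-- The basis element `x ^ i` of the space of polynomials of degree at most `n`, for `i ≤ n`. -/
noncomputable def monomialLE (n : ℕ) (i : Fin (n + 1)) : Polynomial.degreeLE K (n : WithBot ℕ) :=
  ⟨Polynomial.X ^ (i : ℕ), Polynomial.mem_degreeLE.2 <|
    (Polynomial.degree_X_pow_le _).trans (by exact_mod_cast Nat.lt_succ_iff.1 i.2)⟩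

theorem monomialLE_ne_zero (n : ℕ) (i : Fin (n + 1)) : monomialLE K n i ≠ 0 := fun h =>
  pow_ne_zero (i : ℕ) (Polynomial.X_ne_zero (R := K)) (congrArg Subtype.val h)

/-- The term `a_i ⊗ b_j ⊗ c_{i+j}`. -/
noncomputable def stdTerm (n m : ℕ) (p : Fin (n + 1) × Fin (m + 1)) :
    Polynomial.degreeLE K (n : WithBot ℕ) ⊗[K] Polynomial.degreeLE K (m : WithBot ℕ) ⊗[K]
      Polynomial.degreeLE K ((n + m : ℕ) : WithBot ℕ) :=
  monomialLE K n p.1 ⊗ₜ[K] monomialLE K m p.2 ⊗ₜ[K]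
    monomialLE K (n + m) ⟨p.1 + p.2, by have := p.1.2; have := p.2.2; omega⟩

/-- The polynomial multiplication tensor for degrees `n` and `m` over `K`. -/
noncomputable def polyMulTensor (n m : ℕ) :
    Polynomial.degreeLE K (n : WithBot ℕ) ⊗[K] Polynomial.degreeLE K (m : WithBot ℕ) ⊗[K]
      Polynomial.degreeLE K ((n + m : ℕ) : WithBot ℕ) :=
  ∑ p : Fin (n + 1) × Fin (m + 1), stdTerm K n m p

/-- The standard representation of the polynomial multiplication tensor. -/
noncomputable def standardRep (n m : ℕ) : TensorRep (polyMulTensor K n m) where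
  terms := (Finset.univ : Finset (Fin (n + 1) × Fin (m + 1))).val.map (stdTerm K n m)
  pure := by
    intro t ht
    obtain ⟨p, -, rfl⟩ := Multiset.mem_map.1 ht
    exact ⟨_, _, _, monomialLE_ne_zero K _ _, monomialLE_ne_zero K _ _,
      monomialLE_ne_zero K _ _, rfl⟩
  sum_eq := rfl

end PolynomialMultiplication

/-! Lower bounds come from the absence of zero divisors: a nonzero polynomial `f` times a nonzero
`g` is nonzero, so for each `f ≠ 0` at least `m + 1` terms satisfy `u p ⬝ᵥ f ≠ 0`
(`le_card_filter`). Over the field with two elements, a fixed vector is nonorthogonal to only about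
half of the possible `f`, and double counting (`card_mul_le`) settles `n = 1` and `(2, 2)`.

For `(2, 4)`, nine terms would force two equal first factors, as there are only eight vectors.
Counting only those `f` that vanish at the common factor ignores both terms and gives a
contradiction (`ten_le`).

For `(3, m)` with `m ≥ 2`, suppose there are `m + 5` terms. Two equal first factors are excluded as
before. For distinct ones, some `χ ≠ 0` kills the third factors of the other `m + 3` terms, so the
Hankel matrix of `χ` has its columns in the span of the two (`exists_window`). A colouring of the 16
vectors with 6 colours makes this impossible for some pair (`add_six_le`); `(2, 3)` follows by
symmetry.

Upper bounds over `ZMod 2` are explicit move lists, checked by kernel computation on bit-encoded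
terms. Part (b) is interpolation at five points against the bound `n + m + 1`, which holds because
the third factors must span. -/

/-! ### Lower bounds over an arbitrary field. -/

section LowerBounds

variable {K : Type*} [Field K]

/-- The coordinate form of a representation of the polynomial multiplication tensor, terms that
vanish being allowed. -/
def ComputesPolyMul {ι : Type*} [Fintype ι] (n m : ℕ) (u : ι → Fin (n + 1) → K)
    (v : ι → Fin (m + 1) → K) (w : ι → Fin (n + m + 1) → K) : Prop :=
  ∀ i j k, ∑ p, u p i * v p j * w p k = if (i : ℕ) + j = k then 1 else 0

theorem exists_ne_zero_forall_dotProduct_eq_zero {ι : Type*} {d : ℕ} (s : Finset ι)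
    (hs : s.card < d) (x : ι → Fin d → K) : ∃ g : Fin d → K, g ≠ 0 ∧ ∀ p ∈ s, x p ⬝ᵥ g = 0 := by
  have h : LinearMap.ker (Matrix.mulVecLin (Matrix.of fun p : s => x p)) ≠ ⊥ :=
    LinearMap.ker_ne_bot_of_finrank_lt (by simpa using hs)
  obtain ⟨g, hg, hg0⟩ := Submodule.exists_mem_ne_zero_of_ne_bot h
  exact ⟨g, hg0, fun p hp => congrFun (LinearMap.mem_ker.1 hg) ⟨p, hp⟩⟩

namespace ComputesPolyMul

variable {ι : Type*} [Fintype ι] {n m : ℕ} {u : ι → Fin (n + 1) → K}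
  {v : ι → Fin (m + 1) → K} {w : ι → Fin (n + m + 1) → K}

theorem sum_mul_dotProduct (h : ComputesPolyMul n m u v w) (f : Fin (n + 1) → K)
    (g : Fin (m + 1) → K) (k : Fin (n + m + 1)) :
    ∑ p, (u p ⬝ᵥ f) * (v p ⬝ᵥ g) * w p k =
      ∑ i : Fin (n + 1), ∑ j : Fin (m + 1), if (i : ℕ) + j = k then f i * g j else 0 := by
  have h1 : ∀ (i : Fin (n + 1)) (j : Fin (m + 1)), (if (i : ℕ) + j = k then f i * g j else 0) =
      ∑ p, f i * g j * (u p i * v p j * w p k) := fun i j => by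
    rw [← Finset.mul_sum, h i j k]; simp
  simp_rw [h1, dotProduct, Finset.sum_mul_sum, Finset.sum_mul]
  rw [Finset.sum_comm]
  refine Finset.sum_congr rfl fun i _ => ?_
  rw [Finset.sum_comm]
  exact Finset.sum_congr rfl fun j _ => Finset.sum_congr rfl fun p _ => by ring

theorem le_card_filter [DecidableEq K] (h : ComputesPolyMul n m u v w) {f : Fin (n + 1) → K}
    (hf : f ≠ 0) : m + 1 ≤ (Finset.univ.filter fun p => u p ⬝ᵥ f ≠ 0).card := by
  -- With at most `m` such terms, some `g ≠ 0` kills their second factors, and then every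
  -- coefficient of the product of `f` and `g` is zero.
  by_contra! hlt
  obtain ⟨g, hg, hvg⟩ := exists_ne_zero_forall_dotProduct_eq_zero _ hlt v
  have hk : ∀ k : Fin (n + m + 1),
      ∑ i : Fin (n + 1), ∑ j : Fin (m + 1), (if (i : ℕ) + j = k then f i * g j else 0) = 0 :=
    fun k => by
    rw [← h.sum_mul_dotProduct]
    refine Finset.sum_eq_zero fun p _ => ?_
    by_cases hp : u p ⬝ᵥ f = 0
    · simp [hp]
    · simp [hvg p (by simpa using hp)]
  have key : (∑ i : Fin (n + 1), Polynomial.monomial (i : ℕ) (f i)) *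
      (∑ j : Fin (m + 1), Polynomial.monomial (j : ℕ) (g j)) = 0 := by
    ext k
    simp only [Finset.sum_mul_sum, Polynomial.monomial_mul_monomial, Polynomial.finsetSum_coeff,
      Polynomial.coeff_monomial, Polynomial.coeff_zero]
    by_cases hkn : k < n + m + 1
    · exact hk ⟨k, hkn⟩
    · refine Finset.sum_eq_zero fun i _ => Finset.sum_eq_zero fun j _ => if_neg ?_
      omega
  have coeff_sum : ∀ {d : ℕ} (x : Fin d → K),
      ∑ i : Fin d, Polynomial.monomial (i : ℕ) (x i) = 0 → x = 0 := by
    intro d x hx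
    ext i
    have := congrArg (fun p => Polynomial.coeff p (i : ℕ)) hx
    simpa [Polynomial.finsetSum_coeff, Polynomial.coeff_monomial, Fin.val_inj] using this
  rcases mul_eq_zero.1 key with h0 | h0
  · exact hf (coeff_sum f h0)
  · exact hg (coeff_sum g h0)

/-- Double counting of the pairs `(f, p)` with `f ∈ A`, `p ∈ s` and `u p ⬝ᵥ f ≠ 0`. -/
theorem card_mul_le [DecidableEq K] (h : ComputesPolyMul n m u v w)
    (A : Finset (Fin (n + 1) → K)) (hA : ∀ f ∈ A, f ≠ 0) (s : Finset ι)
    (hs : ∀ f ∈ A, ∀ p, u p ⬝ᵥ f ≠ 0 → p ∈ s) (B : ℕ)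
    (hB : ∀ x, (A.filter fun f => x ⬝ᵥ f ≠ 0).card ≤ B) :
    A.card * (m + 1) ≤ s.card * B := by
  refine Finset.card_mul_le_card_mul (fun f p => u p ⬝ᵥ f ≠ 0) (fun f hf => ?_)
    fun p _ => hB (u p)
  refine (h.le_card_filter (hA f hf)).trans (Finset.card_le_card fun p hp => ?_)
  have hp' : u p ⬝ᵥ f ≠ 0 := by simpa using hp
  exact Finset.mem_filter.2 ⟨hs f hf p hp', hp'⟩

theorem swap (h : ComputesPolyMul n m u v w) :
    ComputesPolyMul m n v u fun p k => w p (k.cast (by omega)) := by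
  intro i j k
  rw [add_comm (i : ℕ), ← Fin.val_cast (by omega : m + n + 1 = n + m + 1) k, ← h]
  exact Finset.sum_congr rfl fun p _ => by ring

/-- Adding terms that vanish. -/
theorem exists_fin (h : ComputesPolyMul n m u v w) {r : ℕ} (hr : Fintype.card ι ≤ r) :
    ∃ (u' : Fin r → Fin (n + 1) → K) (v' : Fin r → Fin (m + 1) → K)
      (w' : Fin r → Fin (n + m + 1) → K), ComputesPolyMul n m u' v' w' := by
  obtain ⟨e⟩ : Nonempty (ι ⊕ Fin (r - Fintype.card ι) ≃ Fin r) :=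
    Fintype.card_eq.1 (by simp; omega)
  refine ⟨Sum.elim u 0 ∘ e.symm, Sum.elim v 0 ∘ e.symm, Sum.elim w 0 ∘ e.symm, fun i j k => ?_⟩
  rw [← h i j k, ← e.sum_comp]
  simp [Fintype.sum_sum_type]

/-- Every `k ≤ n + m` splits as `i + j`, so a functional `g` that kills all third factors has `g k =
0` for every `k`; hence these factors span. -/
theorem add_add_one_le_card (h : ComputesPolyMul n m u v w) : n + m + 1 ≤ Fintype.card ι := by
  by_contra! hlt
  obtain ⟨g, hg, hwg⟩ := exists_ne_zero_forall_dotProduct_eq_zero Finset.univ hlt w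
  refine hg (funext fun k => ?_)
  have hi : min (k : ℕ) n < n + 1 := by omega
  have hj : (k : ℕ) - min (k : ℕ) n < m + 1 := by omega
  have h1 : ∀ l, ∑ p, u p ⟨_, hi⟩ * v p ⟨_, hj⟩ * w p l * g l = if k = l then g l else 0 := by
    intro l
    rw [← Finset.sum_mul, h]
    simp [Fin.ext_iff]
  have h2 : ∑ l, ∑ p, u p ⟨_, hi⟩ * v p ⟨_, hj⟩ * w p l * g l = g k := by simp [h1]
  rw [← h2, Finset.sum_comm]
  refine Finset.sum_eq_zero fun p _ => ?_
  have := hwg p (Finset.mem_univ p)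
  simp only [mul_assoc, ← Finset.mul_sum]
  rw [dotProduct] at this
  simp [this]

/-- If two terms are left out, a functional `χ` kills the others, and the Hankel matrix of `χ` has
its columns in the span of the remaining two vectors. -/
theorem exists_window (h : ComputesPolyMul n m u v w) [DecidableEq ι]
    (hr : Fintype.card ι < n + m + 3) {p q : ι} (hpq : p ≠ q) :
    ∃ χ : Fin (n + m + 1) → K, χ ≠ 0 ∧ ∀ j : Fin (m + 1), ∃ a b : K, ∀ i : Fin (n + 1),
      χ ⟨i + j, by omega⟩ = a * u p i + b * u q i := by
  have hc : ((Finset.univ.erase p).erase q).card < n + m + 1 := by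
    rw [Finset.card_erase_of_mem (by simp [hpq.symm]), Finset.card_erase_of_mem (by simp),
      Finset.card_univ]
    omega
  obtain ⟨χ, hχ, hw⟩ := exists_ne_zero_forall_dotProduct_eq_zero _ hc w
  refine ⟨χ, hχ, fun j => ⟨v p j * (w p ⬝ᵥ χ), v q j * (w q ⬝ᵥ χ), fun i => ?_⟩⟩
  -- Contracting the third factor with `χ` turns the multiplication tensor into a Hankel matrix.
  have h1 : χ ⟨i + j, by omega⟩ = ∑ s, u s i * v s j * (w s ⬝ᵥ χ) := by
    simp_rw [dotProduct, Finset.mul_sum]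
    rw [Finset.sum_comm]
    simp_rw [← mul_assoc, ← Finset.sum_mul, h i j]
    rw [Finset.sum_eq_single ⟨i + j, by omega⟩] 
    · simp
    · intro b _ hb
      rw [if_neg, zero_mul]
      exact fun hh => hb (Fin.ext hh.symm)
    · simp
  rw [h1, ← Finset.add_sum_erase _ _ (Finset.mem_univ p),
    ← Finset.add_sum_erase _ _ (show q ∈ Finset.univ.erase p by simp [hpq.symm]),
    Finset.sum_eq_zero fun s hs => by rw [hw s hs, mul_zero]]
  ring

end ComputesPolyMul

end LowerBounds

/-! ### Lower bounds over the field with two elements. -/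

section ModTwo

theorem card_ne_zero_dotProduct_le_two (x : Fin 2 → ZMod 2) :
    ((Finset.univ.erase 0).filter fun f => x ⬝ᵥ f ≠ 0).card ≤ 2 := by
  revert x; decide +kernel

theorem card_ne_zero_dotProduct_le_four (x : Fin 3 → ZMod 2) :
    ((Finset.univ.erase 0).filter fun f => x ⬝ᵥ f ≠ 0).card ≤ 4 := by
  revert x; decide +kernel

/-- The nonzero functionals that vanish at `y`. -/
def annihilator {d : ℕ} (y : Fin d → ZMod 2) : Finset (Fin d → ZMod 2) :=
  Finset.univ.filter fun f => f ≠ 0 ∧ y ⬝ᵥ f = 0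

/-- A linear form that is nonzero on a subspace is nonzero on half of it. The quotient covers `y ≠
0` (2 of 3) and `y = 0` (4 of 7) at once. -/
theorem card_annihilator_filter_three (y x : Fin 3 → ZMod 2) :
    ((annihilator y).filter fun f => x ⬝ᵥ f ≠ 0).card ≤ 2 * (annihilator y).card / 3 := by
  revert y x; decide +kernel

theorem card_annihilator_filter_four (y x : Fin 4 → ZMod 2) :
    ((annihilator y).filter fun f => x ⬝ᵥ f ≠ 0).card ≤ 4 * (annihilator y).card / 7 := by
  revert y x; decide +kernel

theorem card_annihilator_three_pos (y : Fin 3 → ZMod 2) : 0 < (annihilator y).card := by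
  revert y; decide +kernel

theorem card_annihilator_four_pos (y : Fin 4 → ZMod 2) : 0 < (annihilator y).card := by
  revert y; decide +kernel

/-- A colouring for which two distinct vectors of the same colour span a space that contains the
columns of no nonzero Hankel matrix of size `4 × 3`. -/
def hankelColour (x : Fin 4 → ZMod 2) : ℕ :=
  [0, 1, 0, 2, 0, 3, 0, 2, 4, 2, 2, 3, 3, 2, 2, 5].getD
    ((x 0).val + 2 * (x 1).val + 4 * (x 2).val + 8 * (x 3).val) 0

theorem hankelColour_lt (x : Fin 4 → ZMod 2) : hankelColour x < 6 := by
  revert x; decide +kernel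

/-- The vectors with codes 1, 8 and 15 are evaluations at 0, infinity and 1; each spans the columns
of a rank-one Hankel matrix, so its colour class must be a singleton. Parametrising the first column
by `a`, `b` leaves only the last two entries `c`, `d` free in the finite check. -/
theorem hankelColour_spec : ∀ y y' : Fin 4 → ZMod 2, hankelColour y = hankelColour y' → y ≠ y' →
    ∀ a b c d : ZMod 2, let z := fun i => a * y i + b * y' i
    (∃ a b, z 1 = a * y 0 + b * y' 0 ∧ z 2 = a * y 1 + b * y' 1 ∧ z 3 = a * y 2 + b * y' 2 ∧
      c = a * y 3 + b * y' 3) →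
    (∃ a b, z 2 = a * y 0 + b * y' 0 ∧ z 3 = a * y 1 + b * y' 1 ∧ c = a * y 2 + b * y' 2 ∧
      d = a * y 3 + b * y' 3) →
    z 0 = 0 ∧ z 1 = 0 ∧ z 2 = 0 ∧ z 3 = 0 ∧ c = 0 ∧ d = 0 := by
  decide +kernel

theorem eq_zero_of_windows {y y' : Fin 4 → ZMod 2} (h : hankelColour y = hankelColour y')
    (hy : y ≠ y') {x : ℕ → ZMod 2} (hx : ∀ j < 3, ∃ a b : ZMod 2, ∀ i : Fin 4,
      x (i + j) = a * y i + b * y' i) : ∀ i < 6, x i = 0 := by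
  obtain ⟨a, b, h0⟩ := hx 0 (by norm_num)
  obtain ⟨a₁, b₁, h1⟩ := hx 1 (by norm_num)
  obtain ⟨a₂, b₂, h2⟩ := hx 2 (by norm_num)
  have h0' : ∀ i : Fin 4, a * y i + b * y' i = x i := fun i => (h0 i).symm
  obtain ⟨e0, e1, e2, e3, e4, e5⟩ := hankelColour_spec y y' h hy a b (x 4) (x 5)
    ⟨a₁, b₁, (h0' 1).trans (h1 0), (h0' 2).trans (h1 1), (h0' 3).trans (h1 2), h1 3⟩
    ⟨a₂, b₂, (h0' 2).trans (h2 0), (h0' 3).trans (h2 1), h2 2, h2 3⟩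
  intro i hi
  interval_cases i
  exacts [(h0' 0).symm.trans e0, (h0' 1).symm.trans e1, (h0' 2).symm.trans e2,
    (h0' 3).symm.trans e3, e4, e5]

theorem eq_zero_of_windows_of_two_le {y y' : Fin 4 → ZMod 2}
    (h : hankelColour y = hankelColour y') (hy : y ≠ y') {m : ℕ} (hm : 2 ≤ m) {x : ℕ → ZMod 2}
    (hx : ∀ j < m + 1, ∃ a b : ZMod 2, ∀ i : Fin 4, x (i + j) = a * y i + b * y' i) :
    ∀ i < m + 4, x i = 0 := by
  intro i hi
  -- A `4 × 3` Hankel block, shifted just far enough to contain the entry `i` without leaving the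
  -- matrix.
  have := eq_zero_of_windows h hy (x := fun k => x (k + min i (m - 2))) (fun j hj => by
    obtain ⟨a, b, hab⟩ := hx (j + min i (m - 2)) (by omega)
    exact ⟨a, b, fun k => by rw [← hab k, add_assoc]⟩) (i - min i (m - 2)) (by omega)
  rwa [Nat.sub_add_cancel (by omega)] at this

namespace ComputesPolyMul

variable {ι : Type*} [Fintype ι]

theorem three_mul_le {m : ℕ} {u : ι → Fin 2 → ZMod 2} {v : ι → Fin (m + 1) → ZMod 2}
    {w : ι → Fin (1 + m + 1) → ZMod 2} (h : ComputesPolyMul 1 m u v w) :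
    3 * (m + 1) ≤ Fintype.card ι * 2 :=
  h.card_mul_le (Finset.univ.erase 0) (fun _ => Finset.ne_of_mem_erase) Finset.univ
    (fun _ _ _ _ => Finset.mem_univ _) 2 card_ne_zero_dotProduct_le_two

theorem seven_mul_le {m : ℕ} {u : ι → Fin 3 → ZMod 2} {v : ι → Fin (m + 1) → ZMod 2}
    {w : ι → Fin (2 + m + 1) → ZMod 2} (h : ComputesPolyMul 2 m u v w) :
    7 * (m + 1) ≤ Fintype.card ι * 4 :=
  h.card_mul_le (Finset.univ.erase 0) (fun _ => Finset.ne_of_mem_erase) Finset.univ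
    (fun _ _ _ _ => Finset.mem_univ _) 4 card_ne_zero_dotProduct_le_four

/-- Two terms with the same first factor are invisible to the functionals vanishing there. -/
theorem card_annihilator_mul_le {n m : ℕ} {u : ι → Fin (n + 1) → ZMod 2}
    {v : ι → Fin (m + 1) → ZMod 2} {w : ι → Fin (n + m + 1) → ZMod 2}
    (h : ComputesPolyMul n m u v w) {p q : ι} (hpq : p ≠ q) (huv : u p = u q) {B : ℕ}
    (hB : ∀ x, ((annihilator (u p)).filter fun f => x ⬝ᵥ f ≠ 0).card ≤ B) :
    (annihilator (u p)).card * (m + 1) ≤ (Fintype.card ι - 2) * B := by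
  classical
  have := h.card_mul_le (annihilator (u p)) (fun f hf => (Finset.mem_filter.1 hf).2.1)
    ((Finset.univ.erase p).erase q) (fun f hf s hs => by
      have hf0 := (Finset.mem_filter.1 hf).2.2
      simp only [Finset.mem_erase, Finset.mem_univ, and_true]
      exact ⟨fun e => hs (by rw [e, ← huv, hf0]), fun e => hs (by rw [e, hf0])⟩) B hB
  rwa [Finset.card_erase_of_mem (by simp [hpq.symm]), Finset.card_erase_of_mem (by simp),
    Finset.card_univ, Nat.sub_sub] at this

theorem ten_le {u : ι → Fin 3 → ZMod 2} {v : ι → Fin 5 → ZMod 2} {w : ι → Fin 7 → ZMod 2}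
    (h : ComputesPolyMul 2 4 u v w) : 10 ≤ Fintype.card ι := by
  by_contra! hlt
  obtain ⟨u, v, w, h⟩ := h.exists_fin (Nat.le_of_lt_succ hlt)
  -- Nine terms, but only eight vectors.
  obtain ⟨p, q, hpq, huv⟩ := Fintype.exists_ne_map_eq_of_card_lt u (by simp)
  have h1 := h.card_annihilator_mul_le hpq huv (card_annihilator_filter_three _)
  have h2 := card_annihilator_three_pos (u p)
  simp only [Fintype.card_fin] at h1
  omega

theorem add_six_le {m : ℕ} (hm : 2 ≤ m) {u : ι → Fin 4 → ZMod 2}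
    {v : ι → Fin (m + 1) → ZMod 2} {w : ι → Fin (3 + m + 1) → ZMod 2}
    (h : ComputesPolyMul 3 m u v w) : m + 6 ≤ Fintype.card ι := by
  by_contra! hlt
  obtain ⟨u, v, w, h⟩ := h.exists_fin (Nat.le_of_lt_succ hlt)
  -- Since `m ≥ 2`, there are at least seven terms for six colours.
  obtain ⟨p, q, hpq, hcol⟩ := Fintype.exists_ne_map_eq_of_card_lt
    (fun p => (⟨hankelColour (u p), hankelColour_lt _⟩ : Fin 6)) (by simp; omega)
  by_cases huv : u p = u q
  · have h1 := h.card_annihilator_mul_le hpq huv (card_annihilator_filter_four _)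
    have h2 := card_annihilator_four_pos (u p)
    have h3 := Nat.mul_div_le (4 * (annihilator (u p)).card) 7
    simp only [Fintype.card_fin, show m + 5 - 2 = m + 3 by omega] at h1
    -- The count would give `7 * (m + 1) ≤ 4 * (m + 3)`, which fails for `m ≥ 2`.
    nlinarith
  · obtain ⟨χ, hχ, hw⟩ := h.exists_window (by simp; omega) hpq
    refine hχ (funext fun i => ?_)
    have := eq_zero_of_windows_of_two_le (by simpa using hcol) huv hm
      (x := fun k => if hk : k < 3 + m + 1 then χ ⟨k, hk⟩ else 0) (fun j hj => by
        obtain ⟨a, b, hab⟩ := hw ⟨j, hj⟩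
        exact ⟨a, b, fun i => by rw [dif_pos (by omega)]; exact hab i⟩) i (by omega)
    rwa [dif_pos i.2] at this

end ComputesPolyMul

end ModTwo

/-! ### From abstract tensors to coordinates. -/

section TensorRank

variable {K U V W : Type*} [Field K] [AddCommGroup U] [AddCommGroup V] [AddCommGroup W]
  [Module K U] [Module K V] [Module K W]

theorem TensorRep.exists_factors {T : U ⊗[K] V ⊗[K] W} (S : TensorRep T) :
    ∃ (u : Fin S.length → U) (v : Fin S.length → V) (w : Fin S.length → W),
      ∑ p, u p ⊗ₜ[K] v p ⊗ₜ[K] w p = T := by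
  obtain ⟨terms, hpure, hsum⟩ := S
  induction terms using Quotient.inductionOn with | _ l
  have h : ∀ p : Fin l.length, ∃ (u : U) (v : V) (w : W), l[p] = u ⊗ₜ[K] v ⊗ₜ[K] w := fun p => by
    obtain ⟨u, v, w, -, -, -, e⟩ := hpure l[p] (by simp)
    exact ⟨u, v, w, e⟩
  choose u v w e using h
  refine ⟨u, v, w, ?_⟩
  change ∑ p : Fin l.length, u p ⊗ₜ[K] v p ⊗ₜ[K] w p = T
  simp_rw [← e, ← hsum]
  simp

theorem tensorRank_eq {T : U ⊗[K] V ⊗[K] W} {r : ℕ} (S : TensorRep T) (hS : S.length = r)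
    (h : ∀ S : TensorRep T, r ≤ S.length) : tensorRank T = r :=
  le_antisymm (Nat.sInf_le ⟨S, hS⟩) (le_csInf ⟨_, S, rfl⟩ (by rintro _ ⟨S, rfl⟩; exact h S))

/-- The trilinear form `u ⊗ v ⊗ w ↦ φ u * ψ v * χ w`. -/
noncomputable def evalTensor (φ : U →ₗ[K] K) (ψ : V →ₗ[K] K) (χ : W →ₗ[K] K) :
    U ⊗[K] V ⊗[K] W →ₗ[K] K :=
  TensorProduct.lift ((LinearMap.mul K K).compl₁₂
    (TensorProduct.lift ((LinearMap.mul K K).compl₁₂ φ ψ)) χ)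

@[simp]
theorem evalTensor_tmul (φ : U →ₗ[K] K) (ψ : V →ₗ[K] K) (χ : W →ₗ[K] K) (u : U) (v : V) (w : W) :
    evalTensor φ ψ χ (u ⊗ₜ[K] v ⊗ₜ[K] w) = φ u * ψ v * χ w := by
  simp [evalTensor]

end TensorRank

/-! ### Coefficients, interpolation and part (b). -/

section PolyMul

theorem exists_fin_injective {K : Type*} (h : 5 ≤ ENat.card K) :
    ∃ a : Fin 5 → K, Function.Injective a := by
  obtain ⟨t, -, ht⟩ := Set.exists_subset_encard_eq (s := (Set.univ : Set K))
    (k := ((5 : ℕ) : ℕ∞)) (by rw [Set.encard_univ]; exact_mod_cast h)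
  have hfin : t.Finite := Set.finite_of_encard_eq_coe ht
  have := hfin.fintype
  have hc : Fintype.card t = 5 := by
    rw [Set.encard_eq_coe_toFinset_card, Set.toFinset_card] at ht
    exact_mod_cast ht
  exact ⟨fun i => ((Fintype.equivFinOfCardEq hc).symm i : K),
    Subtype.val_injective.comp (Equiv.injective _)⟩

variable {K : Type*} [Field K]

variable (K) in
/-- The `i`-th coefficient of a polynomial of degree at most `n`. -/
noncomputable def coeffLE (n i : ℕ) : Polynomial.degreeLE K (n : WithBot ℕ) →ₗ[K] K :=
  Polynomial.lcoeff K i ∘ₗ Submodule.subtype _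

theorem coeffLE_monomialLE (n : ℕ) (i : ℕ) (j : Fin (n + 1)) :
    coeffLE K n i (monomialLE K n j) = if i = j then 1 else 0 := by
  simp [coeffLE, monomialLE, Polynomial.coeff_X_pow]

theorem evalTensor_polyMulTensor {n m : ℕ} (i : Fin (n + 1)) (j : Fin (m + 1))
    (k : Fin (n + m + 1)) :
    evalTensor (coeffLE K n i) (coeffLE K m j) (coeffLE K (n + m) k) (polyMulTensor K n m) =
      if (i : ℕ) + j = k then 1 else 0 := by
  simp only [polyMulTensor, stdTerm, map_sum, evalTensor_tmul, coeffLE_monomialLE, Fin.val_inj]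
  rw [Finset.sum_eq_single (i, j)]
  · simp [eq_comm]
  · rintro ⟨i', j'⟩ - hne
    by_cases hi : i = i'
    · have : j ≠ j' := fun hj => hne (by rw [hi, hj])
      simp [this]
    · simp [hi]
  · simp

theorem TensorRep.exists_computesPolyMul {n m : ℕ} (S : TensorRep (polyMulTensor K n m)) :
    ∃ (u : Fin S.length → Fin (n + 1) → K) (v : Fin S.length → Fin (m + 1) → K)
      (w : Fin S.length → Fin (n + m + 1) → K), ComputesPolyMul n m u v w := by
  obtain ⟨u, v, w, h⟩ := S.exists_factors
  refine ⟨fun p i => coeffLE K n i (u p), fun p j => coeffLE K m j (v p),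
    fun p k => coeffLE K (n + m) k (w p), fun i j k => ?_⟩
  refine Eq.trans ?_ (evalTensor_polyMulTensor i j k)
  have := congrArg (evalTensor (coeffLE K n i) (coeffLE K m j) (coeffLE K (n + m) k)) h
  simpa only [map_sum, evalTensor_tmul] using this

/-- The representation of the multiplication tensor by evaluation and interpolation at `n + m + 1`
points. -/
theorem exists_tensorRep_of_injective {n m : ℕ} {a : Fin (n + m + 1) → K}
    (ha : Function.Injective a) :
    ∃ S : TensorRep (polyMulTensor K n m), S.length = n + m + 1 := by
  let ev (d : ℕ) (x : K) : Polynomial.degreeLE K (d : WithBot ℕ) :=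
    ∑ i : Fin (d + 1), x ^ (i : ℕ) • monomialLE K d i
  have hev : ∀ d x, ev d x ≠ 0 := fun d x h0 => by
    have := congrArg (coeffLE K d 0) h0
    simp [ev, coeffLE_monomialLE, Fin.sum_univ_succ] at this
  have hdeg : ∀ p, (Lagrange.basis Finset.univ a p).degree = ((n + m : ℕ) : WithBot ℕ) :=
    fun p => by
      rw [Lagrange.degree_basis ha.injOn (Finset.mem_univ p)]
      simp
  let L (p : Fin (n + m + 1)) : Polynomial.degreeLE K ((n + m : ℕ) : WithBot ℕ) :=
    ⟨Lagrange.basis Finset.univ a p, Polynomial.mem_degreeLE.2 (hdeg p).le⟩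
  have hL : ∀ p, L p ≠ 0 := fun p h0 =>
    Lagrange.basis_ne_zero ha.injOn (Finset.mem_univ p) (congrArg Subtype.val h0)
  -- Interpolation at `n + m + 1` points is exact in degree at most `n + m`; with `k = i + j` it
  -- recovers the third factor of each standard term.
  have hinterp : ∀ k : Fin (n + m + 1), ∑ p, a p ^ (k : ℕ) • L p = monomialLE K (n + m) k := by
    intro k
    refine Subtype.ext ?_
    have h1 := Lagrange.eq_interpolate_of_eval_eq (s := Finset.univ) (v := a)
      (f := Polynomial.X ^ (k : ℕ)) (fun p => a p ^ (k : ℕ)) ha.injOn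
      (by
        rw [Polynomial.degree_X_pow, Finset.card_univ, Fintype.card_fin]
        exact_mod_cast k.2) (by simp)
    simp only [monomialLE, h1, Lagrange.interpolate_apply]
    simp [L, Polynomial.smul_eq_C_mul]
  refine ⟨⟨Finset.univ.val.map fun p => ev n (a p) ⊗ₜ[K] ev m (a p) ⊗ₜ[K] L p, ?_, ?_⟩, ?_⟩
  · intro t ht
    obtain ⟨p, -, rfl⟩ := Multiset.mem_map.1 ht
    exact ⟨_, _, _, hev _ _, hev _ _, hL p, rfl⟩
  · change ∑ p, _ = _
    have hp : ∀ p, ev n (a p) ⊗ₜ[K] ev m (a p) ⊗ₜ[K] L p = ∑ ij : Fin (n + 1) × Fin (m + 1),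
        a p ^ (ij.1 + ij.2 : ℕ) • monomialLE K n ij.1 ⊗ₜ[K] monomialLE K m ij.2 ⊗ₜ[K] L p := by
      intro p
      simp only [ev, TensorProduct.sum_tmul, TensorProduct.tmul_sum]
      rw [Finset.sum_comm, ← Fintype.sum_prod_type']
      refine Finset.sum_congr rfl fun ij _ => ?_
      simp only [← TensorProduct.smul_tmul', TensorProduct.tmul_smul, smul_smul, pow_add, mul_comm]
    simp_rw [hp]
    rw [Finset.sum_comm]
    refine Finset.sum_congr rfl fun ij _ => ?_
    simp only [stdTerm, ← hinterp, TensorProduct.tmul_sum, TensorProduct.tmul_smul,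
      TensorProduct.smul_tmul']
  · simp [TensorRep.length]

theorem tensorRank_polyMulTensor_two_two (h : 5 ≤ ENat.card K) :
    tensorRank (polyMulTensor K 2 2) = 5 := by
  obtain ⟨a, ha⟩ := exists_fin_injective h
  obtain ⟨S, hS⟩ := exists_tensorRep_of_injective (n := 2) (m := 2) ha
  refine tensorRank_eq S hS fun S => ?_
  obtain ⟨u, v, w, h⟩ := S.exists_computesPolyMul
  simpa using h.add_add_one_le_card

end PolyMul

/-! ### Flip paths as computable certificates. -/

section FlipPaths

/-- A term, each factor being given by the binary digits of a natural number. -/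
abbrev BitTerm := ℕ × ℕ × ℕ

/-- The flip (`k = 0, 1, 2`, the position in which the terms agree) or reduction (`k = 3, 4, 5`,
three more than the position in which the terms differ) of two terms. -/
def BitTerm.move (k : ℕ) (s t : BitTerm) : Option (List BitTerm) :=
  match k, s, t with
  | 0, (u, v, w), (u', v', w') =>
    if u = u' then some [(u, v ^^^ v', w), (u, v', w' ^^^ w)] else none
  | 1, (u, v, w), (u', v', w') =>
    if v = v' then some [(u ^^^ u', v, w), (u', v, w' ^^^ w)] else none
  | 2, (u, v, w), (u', v', w') =>
    if w = w' then some [(u ^^^ u', v, w), (u', v' ^^^ v, w)] else none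
  | 3, (u, v, w), (u', v', w') =>
    if v = v' ∧ w = w' then some [(u ^^^ u', v, w)] else none
  | 4, (u, v, w), (u', v', w') =>
    if u = u' ∧ w = w' then some [(u, v ^^^ v', w)] else none
  | _, (u, v, w), (u', v', w') =>
    if u = u' ∧ v = v' then some [(u, v, w ^^^ w')] else none

/-- No factor vanishes modulo `x ^ (n + 1)`, `x ^ (m + 1)`, `x ^ (n + m + 1)`, respectively. -/
def BitTerm.isPure (n m : ℕ) (t : BitTerm) : Bool :=
  t.1 % 2 ^ (n + 1) != 0 && t.2.1 % 2 ^ (m + 1) != 0 && t.2.2 % 2 ^ (n + m + 1) != 0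

/-- Apply the move `x.1` to the terms in the places `x.2.1` and `x.2.2`. -/
def bitStep (n m : ℕ) (l : List BitTerm) (x : ℕ × ℕ × ℕ) : Option (List BitTerm) :=
  let s := l.getD x.2.1 0
  let t := l.getD x.2.2 0
  -- Soundness rests on this test alone: it ensures two separate occurrences, whatever default
  -- `getD` returned.
  if s ∈ l ∧ t ∈ l.erase s then
    (BitTerm.move x.1 s t).bind fun new =>
      if new.all (BitTerm.isPure n m) then some (new ++ (l.erase s).erase t) else none
  else none

/-- Apply a list of moves one after the other. -/
def bitRun (n m : ℕ) : List BitTerm → List (ℕ × ℕ × ℕ) → Option (List BitTerm)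
  | l, [] => some l
  | l, x :: xs => (bitStep n m l x).bind fun l' => bitRun n m l' xs

/-- The standard representation. -/
def bitStandard (n m : ℕ) : List BitTerm :=
  (List.finRange (n + 1) ×ˢ List.finRange (m + 1)).map fun p =>
    (2 ^ (p.1 : ℕ), 2 ^ (p.2 : ℕ), 2 ^ (p.1 + p.2 : ℕ))

/-- The polynomial over `ℤ/2ℤ` of degree at most `n` whose coefficients are the digits of `a`. -/
noncomputable def bitPoly (n a : ℕ) : Polynomial.degreeLE (ZMod 2) (n : WithBot ℕ) :=
  ∑ i : Fin (n + 1), if a.testBit i then monomialLE (ZMod 2) n i else 0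

theorem bitPoly_xor (n a b : ℕ) : bitPoly n (a ^^^ b) = bitPoly n a + bitPoly n b := by
  rw [bitPoly, bitPoly, bitPoly, ← Finset.sum_add_distrib]
  refine Finset.sum_congr rfl fun i _ => ?_
  rw [Nat.testBit_xor]
  cases a.testBit i <;> cases b.testBit i <;> simp [ZModModule.add_self]

theorem bitPoly_two_pow (n : ℕ) (i : Fin (n + 1)) :
    bitPoly n (2 ^ (i : ℕ)) = monomialLE (ZMod 2) n i := by
  simp [bitPoly, Nat.testBit_two_pow, Fin.val_inj]

theorem bitPoly_ne_zero {n a : ℕ} (h : a % 2 ^ (n + 1) ≠ 0) : bitPoly n a ≠ 0 := by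
  obtain ⟨i, hi⟩ := Nat.exists_testBit_of_ne_zero h
  rw [Nat.testBit_mod_two_pow, Bool.and_eq_true, decide_eq_true_eq] at hi
  intro h0
  have h1 := congrArg (coeffLE (ZMod 2) n i) h0
  rw [bitPoly, map_sum, Finset.sum_eq_single ⟨i, hi.1⟩] at h1
  · simp [hi.2, coeffLE_monomialLE] at h1
  · intro j _ hj
    have : i ≠ j := fun e => hj (Fin.ext e.symm)
    split <;> simp [coeffLE_monomialLE, this]
  · simp

/-- The tensor encoded by a term. -/
noncomputable def bitTensor (n m : ℕ) (t : BitTerm) :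
    Polynomial.degreeLE (ZMod 2) (n : WithBot ℕ) ⊗[ZMod 2]
      Polynomial.degreeLE (ZMod 2) (m : WithBot ℕ) ⊗[ZMod 2]
      Polynomial.degreeLE (ZMod 2) ((n + m : ℕ) : WithBot ℕ) :=
  bitPoly n t.1 ⊗ₜ bitPoly m t.2.1 ⊗ₜ bitPoly (n + m) t.2.2

theorem isPureTensor_bitTensor {n m : ℕ} {t : BitTerm} (h : t.isPure n m) :
    IsPureTensor (bitTensor n m t) := by
  simp only [BitTerm.isPure, Bool.and_eq_true, bne_iff_ne] at h
  exact ⟨_, _, _, bitPoly_ne_zero h.1.1, bitPoly_ne_zero h.1.2, bitPoly_ne_zero h.2, rfl⟩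

theorem coe_map_bitStandard (n m : ℕ) :
    (↑((bitStandard n m).map (bitTensor n m)) : Multiset _) = (standardRep (ZMod 2) n m).terms := by
  have h : (standardRep (ZMod 2) n m).terms = Multiset.map (stdTerm (ZMod 2) n m)
      ↑(List.finRange (n + 1) ×ˢ List.finRange (m + 1)) := by
    rw [← Multiset.coe_product]
    rfl
  rw [h, Multiset.map_coe, bitStandard, List.map_map]
  congr 2
  funext p
  simp only [Function.comp, bitTensor, stdTerm, bitPoly_two_pow]
  rw [← bitPoly_two_pow (n + m)]

theorem FlipPair.add_eq {K U V W : Type*} [Field K] [AddCommGroup U] [AddCommGroup V]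
    [AddCommGroup W] [Module K U] [Module K V] [Module K W] {s t s' t' : U ⊗[K] V ⊗[K] W}
    (h : FlipPair s t s' t') : s' + t' = s + t := by
  cases h <;>
  simp only [TensorProduct.tmul_add, TensorProduct.add_tmul, TensorProduct.tmul_sub,
    TensorProduct.sub_tmul, TensorProduct.tmul_smul, ← TensorProduct.smul_tmul'] <;> abel

theorem ReductionPair.add_eq {K U V W : Type*} [Field K] [AddCommGroup U] [AddCommGroup V]
    [AddCommGroup W] [Module K U] [Module K V] [Module K W] {s t r : U ⊗[K] V ⊗[K] W}
    (h : ReductionPair s t r) : r = s + t := by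
  cases h <;> simp only [TensorProduct.tmul_add, TensorProduct.add_tmul]

/-- Modulo 2 the only nontrivial flip parameter is 1, and both addition and subtraction become
exclusive or. -/
theorem BitTerm.move_spec {n m k : ℕ} {s t : BitTerm} {new : List BitTerm}
    (h : BitTerm.move k s t = some new) :
    (∃ s' t', new = [s', t'] ∧ FlipPair (bitTensor n m s) (bitTensor n m t)
      (bitTensor n m s') (bitTensor n m t')) ∨
    ∃ r, new = [r] ∧ ReductionPair (bitTensor n m s) (bitTensor n m t) (bitTensor n m r) := by
  obtain ⟨u, v, w⟩ := s
  obtain ⟨u', v', w'⟩ := t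
  unfold BitTerm.move at h
  split at h <;> rename_i e1 e2 <;> obtain ⟨rfl, rfl, rfl⟩ := e1 <;>
    obtain ⟨rfl, rfl, rfl⟩ := e2 <;>
    rw [Option.ite_none_right_eq_some, Option.some_inj] at h <;> obtain ⟨hc, rfl⟩ := h
  · subst hc
    refine Or.inl ⟨_, _, rfl, ?_⟩
    simpa [bitTensor, bitPoly_xor, ZModModule.sub_eq_add] using FlipPair.first (1 : ZMod 2)
      (bitPoly n u) (bitPoly m v) (bitPoly m v') (bitPoly (n + m) w) (bitPoly (n + m) w')
  · subst hc
    refine Or.inl ⟨_, _, rfl, ?_⟩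
    simpa [bitTensor, bitPoly_xor, ZModModule.sub_eq_add] using FlipPair.second (1 : ZMod 2)
      (bitPoly n u) (bitPoly n u') (bitPoly m v) (bitPoly (n + m) w) (bitPoly (n + m) w')
  · subst hc
    refine Or.inl ⟨_, _, rfl, ?_⟩
    simpa [bitTensor, bitPoly_xor, ZModModule.sub_eq_add] using FlipPair.third (1 : ZMod 2)
      (bitPoly n u) (bitPoly n u') (bitPoly m v) (bitPoly m v') (bitPoly (n + m) w)
  · obtain ⟨rfl, rfl⟩ := hc
    refine Or.inr ⟨_, rfl, ?_⟩
    simp only [bitTensor, bitPoly_xor]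
    exact .first _ _ _ _
  · obtain ⟨rfl, rfl⟩ := hc
    refine Or.inr ⟨_, rfl, ?_⟩
    simp only [bitTensor, bitPoly_xor]
    exact .second _ _ _ _
  · obtain ⟨rfl, rfl⟩ := hc
    refine Or.inr ⟨_, rfl, ?_⟩
    simp only [bitTensor, bitPoly_xor]
    exact .third _ _ _ _

theorem exists_adj_of_bitStep {n m : ℕ} {l l' : List BitTerm} {x : ℕ × ℕ × ℕ}
    (h : bitStep n m l x = some l') (S : TensorRep (polyMulTensor (ZMod 2) n m))
    (hS : S.terms = ↑(l.map (bitTensor n m))) :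
    ∃ S', (flipGraph _).Adj S S' ∧ S'.terms = ↑(l'.map (bitTensor n m)) := by
  simp only [bitStep] at h
  generalize l.getD x.2.1 0 = s at h
  generalize l.getD x.2.2 0 = t at h
  rw [Option.ite_none_right_eq_some, Option.bind_eq_some_iff] at h
  obtain ⟨⟨hs, ht⟩, new, hmove, hnew⟩ := h
  rw [Option.ite_none_right_eq_some, Option.some_inj] at hnew
  obtain ⟨hpure, rfl⟩ := hnew
  set R := (l.erase s).erase t
  have hperm : l.Perm (s :: t :: R) :=
    (List.perm_cons_erase hs).trans ((List.perm_cons_erase ht).cons s)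
  have hterms : S.terms = bitTensor n m s ::ₘ bitTensor n m t ::ₘ ↑(R.map (bitTensor n m)) :=
    hS.trans (Multiset.coe_eq_coe.2 (hperm.map _))
  have hsum := S.sum_eq
  have hP := S.pure
  rw [hterms] at hsum hP
  rw [Multiset.sum_cons, Multiset.sum_cons, ← add_assoc] at hsum
  have hnewP : ∀ y ∈ Multiset.ofList ((new ++ R).map (bitTensor n m)), IsPureTensor y := by
    intro y hy
    rw [Multiset.mem_coe, List.map_append, List.mem_append] at hy
    rcases hy with hy | hy
    · obtain ⟨z, hz, rfl⟩ := List.mem_map.1 hy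
      exact isPureTensor_bitTensor (List.all_eq_true.1 hpure z hz)
    · exact hP y (Multiset.mem_cons_of_mem (Multiset.mem_cons_of_mem hy))
  rcases BitTerm.move_spec (n := n) (m := m) hmove with ⟨s', t', rfl, hf⟩ | ⟨r, rfl, hr⟩
  · refine ⟨⟨_, hnewP, ?_⟩, Or.inl ⟨_, _, _, _, _, hf, hterms, rfl⟩, rfl⟩
    simpa [← add_assoc, hf.add_eq] using hsum
  · refine ⟨⟨_, hnewP, ?_⟩, Or.inr ⟨_, _, _, _, hr, hterms, rfl⟩, rfl⟩
    simpa [hr.add_eq] using hsum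

theorem exists_hasFlipPath_of_bitRun {n m : ℕ} (xs : List (ℕ × ℕ × ℕ)) {l l' : List BitTerm}
    (h : bitRun n m l xs = some l') (S : TensorRep (polyMulTensor (ZMod 2) n m))
    (hS : S.terms = ↑(l.map (bitTensor n m))) :
    ∃ S', HasFlipPath S S' ∧ S'.terms = ↑(l'.map (bitTensor n m)) := by
  induction xs generalizing l S with
  | nil =>
    obtain rfl : l = l' := by simpa [bitRun] using h
    exact ⟨S, .refl, hS⟩
  | cons x xs ih =>
    rw [bitRun, Option.bind_eq_some_iff] at h
    obtain ⟨l₁, h1, h2⟩ := h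
    obtain ⟨S₁, hadj, hS₁⟩ := exists_adj_of_bitStep h1 S hS
    obtain ⟨S', hpath, hS'⟩ := ih h2 S₁ hS₁
    exact ⟨S', .head hadj hpath, hS'⟩

theorem exists_hasFlipPath {n m r : ℕ} (xs : List (ℕ × ℕ × ℕ))
    (h : (bitRun n m (bitStandard n m) xs).map List.length = some r) :
    ∃ S, HasFlipPath (standardRep (ZMod 2) n m) S ∧ S.length = r := by
  obtain ⟨l, hl, rfl⟩ := Option.map_eq_some_iff.1 h
  obtain ⟨S, hS, hterms⟩ := exists_hasFlipPath_of_bitRun xs hl _ (coe_map_bitStandard n m).symm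
  exact ⟨S, hS, by rw [TensorRep.length, hterms]; simp⟩

theorem tensorRank_eq_and_exists_hasFlipPath {n m r : ℕ}
    (hle : ∀ {s : ℕ} {u : Fin s → Fin (n + 1) → ZMod 2} {v : Fin s → Fin (m + 1) → ZMod 2}
      {w : Fin s → Fin (n + m + 1) → ZMod 2}, ComputesPolyMul n m u v w → r ≤ s)
    (xs : List (ℕ × ℕ × ℕ))
    (h : (bitRun n m (bitStandard n m) xs).map List.length = some r) :
    tensorRank (polyMulTensor (ZMod 2) n m) = r ∧
      ∃ S : TensorRep (polyMulTensor (ZMod 2) n m), HasFlipPath (standardRep (ZMod 2) n m) S ∧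
        S.length = tensorRank (polyMulTensor (ZMod 2) n m) := by
  obtain ⟨S, hpath, hS⟩ := exists_hasFlipPath xs h
  have hrank : tensorRank (polyMulTensor (ZMod 2) n m) = r := tensorRank_eq S hS fun S' => by
    obtain ⟨u, v, w, hc⟩ := S'.exists_computesPolyMul
    exact hle hc
  exact ⟨hrank, S, hpath, hS.trans hrank.symm⟩

end FlipPaths

/-! ### The theorem, with its move lists. -/

theorem mainTheorem3 :
    (∀ n m r : ℕ,
      (n, m, r) ∈ ([(1, 1, 3), (1, 2, 5), (1, 3, 6), (1, 4, 8), (1, 5, 9),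
        (2, 2, 6), (2, 3, 8), (2, 4, 10), (3, 3, 9)] : List (ℕ × ℕ × ℕ)) →
      tensorRank (polyMulTensor (ZMod 2) n m) = r ∧
        ∃ S : TensorRep (polyMulTensor (ZMod 2) n m),
          HasFlipPath (standardRep (ZMod 2) n m) S ∧
            S.length = tensorRank (polyMulTensor (ZMod 2) n m)) ∧
    (∀ (K : Type*) [Field K], 5 ≤ ENat.card K → tensorRank (polyMulTensor K 2 2) = 5) := by
  refine ⟨fun n m r h => ?_, fun K _ hK => tensorRank_polyMulTensor_two_two hK⟩
  have one : ∀ {m s : ℕ} {u : Fin s → Fin 2 → ZMod 2} {v : Fin s → Fin (m + 1) → ZMod 2}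
      {w : Fin s → Fin (1 + m + 1) → ZMod 2}, ComputesPolyMul 1 m u v w →
      3 * (m + 1) ≤ s * 2 := fun hc => by simpa using hc.three_mul_le
  simp only [List.mem_cons, Prod.mk.injEq, List.not_mem_nil, or_false] at h
  rcases h with ⟨rfl, rfl, rfl⟩ | ⟨rfl, rfl, rfl⟩ | ⟨rfl, rfl, rfl⟩ | ⟨rfl, rfl, rfl⟩ |
    ⟨rfl, rfl, rfl⟩ | ⟨rfl, rfl, rfl⟩ | ⟨rfl, rfl, rfl⟩ | ⟨rfl, rfl, rfl⟩ | ⟨rfl, rfl, rfl⟩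
  · exact tensorRank_eq_and_exists_hasFlipPath (fun hc => by have := one hc; omega)
      -- Each triple is a move and two places in the current list, where every step puts its new
      -- terms in front.
      [(0,1,0),(2,0,2),(5,1,3)] (by decide +kernel)
  · exact tensorRank_eq_and_exists_hasFlipPath (fun hc => by have := one hc; omega)
      [(0,3,4),(0,4,3),(3,1,3)] (by decide +kernel)
  · exact tensorRank_eq_and_exists_hasFlipPath (fun hc => by have := one hc; omega)
      [(1,3,7),(2,7,0),(5,5,0),(0,4,3),(0,5,6),(3,2,0)] (by decide +kernel)
  · exact tensorRank_eq_and_exists_hasFlipPath (fun hc => by have := one hc; omega)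
      [(1,4,9),(1,4,8),(2,9,2),(5,7,0),(2,8,2),(5,7,0)] (by decide +kernel)
  · exact tensorRank_eq_and_exists_hasFlipPath (fun hc => by have := one hc; omega)
      [(0,6,7),(2,0,3),(5,3,1),(0,4,3),(2,0,7),(5,1,8),(0,8,9),(0,9,8),(3,0,2)]
      (by decide +kernel)
  · exact tensorRank_eq_and_exists_hasFlipPath
      (fun hc => by have := hc.seven_mul_le; simp only [Fintype.card_fin] at this; omega)
      [(0,1,0),(0,5,4),(0,6,8),(0,8,1),(3,3,0),(0,6,5),(3,0,4),(2,5,6),(5,1,6)]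
      (by decide +kernel)
  · exact tensorRank_eq_and_exists_hasFlipPath
      -- The colouring lives on the factor of degree 3, so the two factors are exchanged.
      (fun hc => by simpa using hc.swap.add_six_le le_rfl)
      [(0,2,0),(2,10,7),(1,4,7),(2,6,8),(5,1,5),(1,8,7),(4,1,5),(0,1,5),(3,6,0),(0,4,5),(0,7,8),
        (3,2,0)] (by decide +kernel)
  · exact tensorRank_eq_and_exists_hasFlipPath (fun hc => by simpa using hc.ten_le)
      [(2,2,10),(1,8,12),(1,5,9),(0,11,10),(0,3,11),(1,12,4),(2,4,13),(5,1,14),(2,2,7),(4,12,0),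
        (0,1,3),(2,6,10),(3,10,1),(0,4,11),(2,4,0),(5,3,1),(0,10,0),(1,3,6),(2,10,0),(5,4,0)]
      (by decide +kernel)
  · exact tensorRank_eq_and_exists_hasFlipPath
      (fun hc => by simpa using hc.add_six_le (by norm_num))
      [(1,9,13),(0,8,6),(1,6,11),(1,5,9),(2,9,13),(2,8,0),(2,0,2),(1,10,3),(1,0,1),(1,2,0),(1,1,2),
        (1,0,1),(0,8,11),(0,2,11),(1,10,14),(0,10,12),(0,10,3),(1,13,6),(4,13,0),(0,4,8),(0,0,6),
        (2,12,11),(2,10,3),(1,13,14),(5,5,0),(0,11,0),(0,0,1),(1,6,10),(1,1,0),(4,8,0),(5,6,0),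
        (1,9,2),(4,4,1),(2,9,10),(5,0,6),(2,5,7),(5,8,1)] (by decide +kernel)
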